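/- Let $R$ be a $(q,s)$ finite chain ring: a finite commutative ring with $1\neq 0$ whose ideals are totally ordered by inclusion, with maximal ideal $\langle\pi\rangle$, residue field $R/\langle\pi\rangle$ of size $q$, and $s$ the smallest positive integer with $\pi^s=0$. An $s$-shape is a sequence of integers $\mu=(\mu_1,\dots,\mu_s)$ with $0\le\mu_1\le\cdots\le\mu_s$; put $\mu_0=0$. For an $s$-shape $\mu$ let $$R^\mu=\underbrace{\langle 1\rangle\times\cdots\times\langle 1\rangle}_{\mu_1}\times\underbrace{\langle\pi\rangle\times\cdots\times\langle\pi\rangle}_{\mu_2-\mu_1}\times\cdots\times\underbrace{\langle\pi^{s-1}\rangle\times\cdots\times\langle\pi^{s-1}\rangle}_{\mu_s-\mu_{s-1}}\subseteq R^{\mu_s}.$$ A finite $R$-module has shape $\kappa$ if it is isomorphic to $R^\kappa$, and a matrix has shape $\kappa$ if its row span does. For $n\ge 0$ let $R^{n\times\mu}$ be the set of $n\times\mu_s$ matrices over $R$ whose rows all lie in $R^\mu$, and let $\mathcal T_\kappa(R^{n\times\mu})$ be the set of matrices in $R^{n\times\mu}$ of shape $\kappa$. Put $$\left[{\mu\atop\kappa}\right]=\prod_{i=1}^{s}q^{(\mu_i-\kappa_i)\kappa_{i-1}}\left[{\mu_i-\kappa_{i-1}\atop\kappa_i-\kappa_{i-1}}\right]_q,\qquad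 \left[{m\atop k}\right]_q=\prod_{i=0}^{k-1}\frac{q^m-q^i}{q^k-q^i}\quad(m\in\mathbb Z,\ k\ge 0).$$ Theorem. For every $n\ge 0$ and all $s$-shapes $\mu,\kappa$, $$|\mathcal T_\kappa(R^{n\times\mu})|=|R^{n\times\kappa}|\cdot\prod_{i=0}^{\kappa_s-1}\bigl(1-q^{i-n}\bigr)\cdot\left[{\mu\atop\kappa}\right],$$ and $\left[{\mu\atop\kappa}\right]$ is the number of submodules of $R^\mu$ of shape $\kappa$. (If $\kappa_i>\mu_i$ for some $i$, or $\kappa_s>n$, both sides of the displayed identity are $0$.) -/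

import Mathlib

/-- `R` is a `(q, s)` chain ring and `π` is a generator of its maximal ideal: `R` is a finite
nonzero commutative ring, any two of its ideals are comparable, the ideal `⟨π⟩` is maximal (hence
the unique maximal ideal), the residue field `R / ⟨π⟩` has `q` elements, and `s` is the smallest
positive integer with `π ^ s = 0`. -/
structure IsFiniteChainRing (R : Type*) [CommRing R] (π : R) (q s : ℕ) : Prop where
  nontrivial : Nontrivial R
  finite : Finite R
  ideals_comparable : ∀ I J : Ideal R, I ≤ J ∨ J ≤ I
  isMaximal : (Ideal.span {π}).IsMaximal
  card_residue : Nat.card (R ⧸ Ideal.span {π}) = q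
  chain_length : IsLeast {k : ℕ | 0 < k ∧ π ^ k = 0} s

/-- An `s`-shape `μ = (μ_1, …, μ_s)`: a non-decreasing sequence of `s` natural numbers.
The entry `μ_{i+1}` is `μ.parts i`. -/
structure ChainShape (s : ℕ) where
  parts : Fin s → ℕ
  mono : Monotone parts

/-- `μ.comp i` is the component `μ_i` for `1 ≤ i ≤ s`, and `μ_0 = 0`. (The value for `i > s` is
irrelevant.) -/
def ChainShape.comp {s : ℕ} (μ : ChainShape s) : ℕ → ℕ
  | 0 => 0
  | i + 1 => if h : i < s then μ.parts ⟨i, h⟩ else 0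

/-- The number of indices `i` in `{1, …, s}` with `μ_i ≤ j`. For a (zero-based) coordinate
`j < μ_s` it is the unique `l < s` with `μ_l ≤ j < μ_{l+1}`. -/
def ChainShape.level {s : ℕ} (μ : ChainShape s) (j : ℕ) : ℕ :=
  (Finset.univ.filter (fun i : Fin s => μ.parts i ≤ j)).card

/-- The module `R^μ`: all `μ_s`-tuples over `R` whose first `μ_1` entries are arbitrary, whose next
`μ_2 - μ_1` entries lie in `⟨π⟩`, …, and whose last `μ_s - μ_{s-1}` entries lie
in `⟨π ^ (s - 1)⟩`. -/
def shapeModule {R : Type*} [CommRing R] (π : R) {s : ℕ} (μ : ChainShape s) :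
    Submodule R (Fin (μ.comp s) → R) :=
  Submodule.pi Set.univ (fun j => Ideal.span {π ^ μ.level j})

/-- The module `M` has shape `κ`, i.e. `M` is isomorphic to `R^κ`. -/
def HasShape {R : Type*} [CommRing R] (π : R) {s : ℕ} (M : Type*) [AddCommGroup M] [Module R M]
    (κ : ChainShape s) : Prop :=
  Nonempty (M ≃ₗ[R] shapeModule π κ)

/-- `R^{n × μ}`: the `n × μ_s` matrices over `R` all of whose rows lie in `R^μ`. -/
def shapedMatrices {R : Type*} [CommRing R] (π : R) {s : ℕ} (n : ℕ) (μ : ChainShape s) :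
    Set (Matrix (Fin n) (Fin (μ.comp s)) R) :=
  {A | ∀ i, A.row i ∈ shapeModule π μ}

/-- The row span of a matrix. -/
def rowSpan {R : Type*} [CommRing R] {n m : ℕ} (A : Matrix (Fin n) (Fin m) R) :
    Submodule R (Fin m → R) :=
  Submodule.span R (Set.range A.row)

/-- `T_κ(R^{n × μ})`: the matrices in `R^{n × μ}` of shape `κ`, the shape of a matrix being the
shape of its row span. -/
def shapedMatricesOfShape {R : Type*} [CommRing R] (π : R) {s : ℕ} (n : ℕ) (μ κ : ChainShape s) :
    Set (Matrix (Fin n) (Fin (μ.comp s)) R) :=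
  {A | A ∈ shapedMatrices π n μ ∧ HasShape π (rowSpan A) κ}

/-- The Gaussian coefficient `∏_{i=0}^{k-1} (q^m - q^i) / (q^k - q^i)`. The upper argument is an
integer so that differences can be inserted without truncation. -/
def gaussCoeff (q : ℕ) (m : ℤ) (k : ℕ) : ℚ :=
  ∏ i ∈ Finset.range k, ((q : ℚ) ^ m - (q : ℚ) ^ i) / ((q : ℚ) ^ k - (q : ℚ) ^ i)

/-- The coefficient
`∏_{i=1}^{s} q^{(μ_i - κ_i) κ_{i-1}} [μ_i - κ_{i-1} choose κ_i - κ_{i-1}]_q`.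
The only natural number subtraction, `κ_i - κ_{i-1}`, does not truncate because `κ` is
non-decreasing. -/
def shapeCoeff (q : ℕ) {s : ℕ} (μ κ : ChainShape s) : ℚ :=
  ∏ i ∈ Finset.Icc 1 s,
    (q : ℚ) ^ (((μ.comp i : ℤ) - (κ.comp i : ℤ)) * (κ.comp (i - 1) : ℤ)) *
      gaussCoeff q ((μ.comp i : ℤ) - (κ.comp (i - 1) : ℤ)) (κ.comp i - κ.comp (i - 1))

/-! The number of submodules of shape κ enters two counts. Injections R^κ → R^μ, sorted by image,
number (submodules) · |Aut R^κ|; matrices of shape κ, sorted by row span, number (submodules) ·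
(generating n-tuples of R^κ). See `natCard_injective_eq_card_submodules_mul` and
`natCard_tuples_eq_card_submodules_mul`.

Injections and generating tuples are both governed by `SocleIndependent`. A map out of R^κ is
injective iff it is injective on the π-torsion (`chainModule.injective_iff`). Dually, n rows
generate R^κ iff no nonzero functional into the π-torsion of R kills them, and this says that the
columns are socle independent in R^n (`chainModule.span_range_eq_top_iff`).

`natCard_socleIndependent` counts such tuples in any finite M: after j choices, the next entry y, of
level l, satisfies π^(s-l) y = 0 while π^(s-1-l) y avoids a space of q^j elements, which leaves
|M[π^(s-l)]| - q^j |M[π^(s-1-l)]| choices. For M = R^n the product is |R^{n×κ}| ∏ (1 - q^(i-n)). The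
counts for M = R^μ and M = R^κ have the Gaussian-type coefficient as quotient, by a summation by
parts in the exponent of q (`shapeCoeff_mul_prod`). -/

theorem LinearMap.natCard_eq_card_ker_mul_card_range {R M N : Type*} [Ring R] [AddCommGroup M]
    [Module R M] [AddCommGroup N] [Module R N] (f : M →ₗ[R] N) :
    Nat.card M = Nat.card (LinearMap.ker f) * Nat.card (LinearMap.range f) := by
  rw [Submodule.card_eq_card_quotient_mul_card (LinearMap.ker f),
    Nat.card_congr f.quotKerEquivRange.toEquiv]

theorem Submodule.natCard_eq_card_inf_ker_mul_card_map {R M N : Type*} [Ring R] [AddCommGroup M]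
    [Module R M] [AddCommGroup N] [Module R N] (f : M →ₗ[R] N) (K : Submodule R M) :
    Nat.card K = Nat.card (K ⊓ LinearMap.ker f : Submodule R M) * Nat.card (K.map f) := by
  rw [LinearMap.natCard_eq_card_ker_mul_card_range (f.domRestrict K), LinearMap.range_domRestrict]
  congr 1
  refine Nat.card_congr
    { toFun := fun x => ⟨x.1.1, x.1.2, x.2⟩
      invFun := fun x => ⟨⟨x.1, x.2.1⟩, x.2.2⟩
      left_inv := fun _ => rfl
      right_inv := fun _ => rfl }

/-! ### Arithmetic of finite chain rings -/

namespace IsFiniteChainRing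

variable {R : Type*} [CommRing R] {π : R} {q s : ℕ}

theorem chain_length_pos (hR : IsFiniteChainRing R π q s) : 0 < s := hR.chain_length.1.1

theorem pow_eq_zero_iff (hR : IsFiniteChainRing R π q s) {k : ℕ} : π ^ k = 0 ↔ s ≤ k := by
  have := hR.nontrivial
  constructor
  · intro h
    rcases Nat.eq_zero_or_pos k with rfl | hk
    · simp at h
    · exact hR.chain_length.2 ⟨hk, h⟩
  · exact fun h => pow_eq_zero_of_le h hR.chain_length.1.2

theorem isUnit_of_not_dvd (hR : IsFiniteChainRing R π q s) {x : R} (hx : ¬ π ∣ x) : IsUnit x := by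
  rw [← Ideal.span_singleton_eq_top]
  rw [← Ideal.span_singleton_le_span_singleton] at hx
  exact hR.isMaximal.out.2 _ (lt_of_le_not_ge ((hR.ideals_comparable _ _).resolve_left hx) hx)

theorem eq_span_of_isMaximal (hR : IsFiniteChainRing R π q s) {I : Ideal R} (hI : I.IsMaximal) :
    I = Ideal.span {π} := by
  rcases hR.ideals_comparable I (Ideal.span {π}) with h | h
  · exact hI.eq_of_le hR.isMaximal.ne_top h
  · exact (hR.isMaximal.eq_of_le hI.ne_top h).symm

theorem exists_eq_pow_mul (hR : IsFiniteChainRing R π q s) {x : R} (hx : x ≠ 0) :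
    ∃ k < s, ∃ u, IsUnit u ∧ x = π ^ k * u := by
  classical
  have hex : ∃ k, ¬ π ^ (k + 1) ∣ x := by
    refine ⟨s, fun h => hx ?_⟩
    rwa [hR.pow_eq_zero_iff.2 (Nat.le_succ s), zero_dvd_iff] at h
  have hdvd : π ^ Nat.find hex ∣ x := by
    rcases h : Nat.find hex with _ | k
    · simp
    · exact not_not.1 (Nat.find_min hex (m := k) (by omega))
  obtain ⟨u, hu⟩ := hdvd
  refine ⟨Nat.find hex, ?_, u, hR.isUnit_of_not_dvd ?_, hu⟩
  · by_contra! h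
    rw [hR.pow_eq_zero_iff.2 h, zero_mul] at hu
    exact hx hu
  · rintro ⟨v, rfl⟩
    exact Nat.find_spec hex ⟨v, hu.trans (by ring)⟩

theorem pow_mul_eq_zero_iff (hR : IsFiniteChainRing R π q s) {a : ℕ} {x : R} :
    π ^ a * x = 0 ↔ π ^ (s - a) ∣ x := by
  constructor
  · intro h
    by_cases hx : x = 0
    · simp [hx]
    obtain ⟨k, -, u, hu, rfl⟩ := hR.exists_eq_pow_mul hx
    rw [← mul_assoc, hu.mul_left_eq_zero, ← pow_add, hR.pow_eq_zero_iff] at h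
    exact Dvd.dvd.mul_right (pow_dvd_pow _ (by omega)) _
  · rintro ⟨y, rfl⟩
    rw [← mul_assoc, ← pow_add, hR.pow_eq_zero_iff.2 (by omega), zero_mul]

theorem mul_pow_pred_eq_zero_iff (hR : IsFiniteChainRing R π q s) {x : R} :
    x * π ^ (s - 1) = 0 ↔ π ∣ x := by
  have := hR.chain_length_pos
  rw [mul_comm, hR.pow_mul_eq_zero_iff, show s - (s - 1) = 1 by omega, pow_one]

/-- For l < s, multiplication by π maps ⟨π^l⟩ onto ⟨π^(l+1)⟩ with kernel ⟨π^(s-1)⟩ ≅ R/⟨π⟩, so each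
step down the chain divides the size by q. -/
theorem natCard_span_pow (hR : IsFiniteChainRing R π q s) (l : ℕ) :
    Nat.card (Ideal.span {π ^ l}) = q ^ (s - l) := by
  have top : Nat.card (Ideal.span {π ^ (s - 1)}) = q := by
    rw [← hR.card_residue]
    have h := LinearMap.quotKerEquivRange (LinearMap.toSpanSingleton R R (π ^ (s - 1)))
    have hk : LinearMap.ker (LinearMap.toSpanSingleton R R (π ^ (s - 1))) = Ideal.span {π} := by
      ext x
      rw [LinearMap.mem_ker, LinearMap.toSpanSingleton_apply, smul_eq_mul,
        hR.mul_pow_pred_eq_zero_iff, Ideal.mem_span_singleton]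
    rw [hk, LinearMap.range_toSpanSingleton] at h
    exact (Nat.card_congr h.toEquiv).symm
  have key : ∀ d l, d + l = s → Nat.card (Ideal.span {π ^ l}) = q ^ d := by
    intro d
    induction d with
    | zero =>
      intro l hl
      rw [hR.pow_eq_zero_iff.2 (by omega)]
      simp
    | succ d ih =>
      intro l hl
      rw [Submodule.natCard_eq_card_inf_ker_mul_card_map (LinearMap.lsmul R R π), pow_succ',
        ← ih (l + 1) (by omega), ← top]
      congr 2
      · congr 2
        ext x
        simp only [Submodule.mem_inf, LinearMap.mem_ker, LinearMap.lsmul_apply, smul_eq_mul,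
          Ideal.mem_span_singleton]
        have := hR.pow_mul_eq_zero_iff (a := 1) (x := x)
        rw [pow_one] at this
        rw [this]
        exact ⟨fun h => h.2, fun h => ⟨(pow_dvd_pow _ (by omega)).trans h, h⟩⟩
      · congr 2
        rw [Ideal.span, Submodule.map_span, Set.image_singleton, pow_succ']
        rfl
  rcases le_total l s with h | h
  · exact key _ _ (by omega)
  · rw [hR.pow_eq_zero_iff.2 h, Nat.sub_eq_zero_of_le h]
    simp

theorem one_lt_card_residue (hR : IsFiniteChainRing R π q s) : 1 < q := by
  have := hR.finite
  have : Finite (R ⧸ Ideal.span {π}) := Finite.of_surjective _ Ideal.Quotient.mk_surjective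
  have : Nontrivial (R ⧸ Ideal.span {π}) := Ideal.Quotient.nontrivial_iff.2 hR.isMaximal.ne_top
  rw [← hR.card_residue]
  exact Finite.one_lt_card

end IsFiniteChainRing

/-! ### Counting socle-independent tuples -/

/-- The tuple `x` satisfies `π ^ (s - l j) • x j = 0` for all `j`, and the elements
`π ^ (s - 1 - l j) • x j` of the `π`-torsion of `M` are linearly independent over `R / ⟨π⟩`. -/
def SocleIndependent {R M : Type*} [CommRing R] [AddCommGroup M] [Module R M] (π : R) (s : ℕ)
    {m : ℕ} (l : Fin m → ℕ) (x : Fin m → M) : Prop :=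
  (∀ j, π ^ (s - l j) • x j = 0) ∧
    ∀ c : Fin m → R, ∑ j, c j • π ^ (s - 1 - l j) • x j = 0 → ∀ j, π ∣ c j

namespace IsFiniteChainRing

open Submodule

variable {R M : Type*} [CommRing R] [AddCommGroup M] [Module R M] {π : R} {q s : ℕ}

theorem natCard_span_of_independent (hR : IsFiniteChainRing R π q s) {m : ℕ} {v : Fin m → M}
    (hv : ∀ j, π • v j = 0) (hind : ∀ c : Fin m → R, ∑ j, c j • v j = 0 → ∀ j, π ∣ c j) :
    Nat.card (span R (Set.range v)) = q ^ m := by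
  have := hR.finite
  have h1 := LinearMap.natCard_eq_card_ker_mul_card_range (Fintype.linearCombination R v)
  have hk : Nat.card (LinearMap.ker (Fintype.linearCombination R v)) =
      Nat.card (Ideal.span {π}) ^ m := by
    rw [show Nat.card (Ideal.span {π}) ^ m = Nat.card (Fin m → Ideal.span {π}) by
      rw [Nat.card_fun, Nat.card_fin]]
    refine Nat.card_congr
      { toFun := fun c j => ⟨c.1 j, Ideal.mem_span_singleton.2 (hind c.1 c.2 j)⟩
        invFun := fun c => ⟨fun j => (c j).1, ?_⟩
        left_inv := fun _ => rfl
        right_inv := fun _ => rfl }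
    rw [LinearMap.mem_ker, Fintype.linearCombination_apply]
    refine Finset.sum_eq_zero fun j _ => ?_
    obtain ⟨d, hd⟩ := Ideal.mem_span_singleton.1 (c j).2
    rw [hd, mul_comm, mul_smul, hv, smul_zero]
  rw [Fintype.range_linearCombination, hk, Nat.card_fun, Nat.card_fin,
    card_eq_card_quotient_mul_card (Ideal.span {π}), hR.card_residue, mul_pow] at h1
  exact (Nat.eq_of_mul_eq_mul_left (pow_pos Nat.card_pos _) h1).symm

/-- The inductive step of the count: extending an independent tuple only requires the new socle
vector to lie outside the span of the old ones, as in linear algebra over R/⟨π⟩. -/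
theorem socleIndependent_snoc (hR : IsFiniteChainRing R π q s) {m : ℕ} {l : Fin (m + 1) → ℕ}
    (hl : ∀ j, l j < s) (x : Fin m → M) (y : M) :
    SocleIndependent π s l (Fin.snoc (α := fun _ => M) x y) ↔
      SocleIndependent π s (fun j => l j.castSucc) x ∧ π ^ (s - l (Fin.last m)) • y = 0 ∧
        π ^ (s - 1 - l (Fin.last m)) • y ∉
          span R (Set.range fun j : Fin m => π ^ (s - 1 - l j.castSucc) • x j) := by
  have htor : ∀ {k : ℕ} {z : M}, k < s → π ^ (s - k) • z = 0 → π • π ^ (s - 1 - k) • z = 0 := by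
    intro k z hk hz
    rwa [smul_smul, ← pow_succ', show s - 1 - k + 1 = s - k by omega]
  simp only [SocleIndependent, Fin.forall_fin_succ', Fin.sum_univ_castSucc, Fin.snoc_castSucc,
    Fin.snoc_last]
  constructor
  · rintro ⟨⟨h1, h2⟩, h3⟩
    refine ⟨⟨h1, fun c hc => ?_⟩, h2, fun hmem => ?_⟩
    · have := h3 (Fin.snoc (α := fun _ => R) c 0) (by simpa using hc)
      simpa using this.1
    · rw [← Fintype.range_linearCombination] at hmem
      obtain ⟨c, hc⟩ := hmem
      rw [Fintype.linearCombination_apply] at hc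
      -- Coefficient -1 turns membership in the span into a relation, and independence would make π
      -- divide a unit.
      have := (h3 (Fin.snoc (α := fun _ => R) c (-1)) (by simp [hc])).2
      rw [Fin.snoc_last, dvd_neg] at this
      exact hR.isMaximal.ne_top (Ideal.span_singleton_eq_top.2 (isUnit_of_dvd_one this))
  · rintro ⟨⟨h1, h3⟩, h2, hmem⟩
    refine ⟨⟨h1, h2⟩, fun c hc => ?_⟩
    have hlast : π ∣ c (Fin.last m) := by
      by_contra hndvd
      obtain ⟨u, hu⟩ := hR.isUnit_of_not_dvd hndvd
      apply hmem
      have hy : π ^ (s - 1 - l (Fin.last m)) • y = -((↑u⁻¹ : R) •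
          ∑ j : Fin m, c j.castSucc • π ^ (s - 1 - l j.castSucc) • x j) := by
        rw [eq_neg_of_add_eq_zero_left hc, ← hu, smul_neg, neg_neg, smul_smul, Units.inv_mul,
          one_smul]
      rw [hy]
      exact neg_mem (smul_mem _ _ (sum_mem fun j _ => smul_mem _ _ (subset_span ⟨j, rfl⟩)))
    refine ⟨h3 (fun j => c j.castSucc) ?_, hlast⟩
    obtain ⟨d, hd⟩ := hlast
    rwa [hd, mul_comm, mul_smul, htor (hl _) h2, smul_zero, add_zero] at hc

/-- The excluded y form the preimage of W under multiplication by π^a on the π^(a+1)-torsion. Since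
W lies in the image, this preimage has |W| · |M[π^a]| elements. -/
theorem natCard_torsionBy_sub [Finite M] {a : ℕ} (W : Submodule R M)
    (hW : W ≤ (torsionBy R M (π ^ (a + 1))).map (LinearMap.lsmul R M (π ^ a))) :
    (Nat.card {y : M // π ^ (a + 1) • y = 0 ∧ π ^ a • y ∉ W} : ℚ) =
      Nat.card (torsionBy R M (π ^ (a + 1))) -
        Nat.card W * Nat.card (torsionBy R M (π ^ a)) := by
  set f : M →ₗ[R] M := LinearMap.lsmul R M (π ^ a)
  set K : Submodule R M := torsionBy R M (π ^ (a + 1)) ⊓ W.comap f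
  have hK : Nat.card K = Nat.card W * Nat.card (torsionBy R M (π ^ a)) := by
    rw [natCard_eq_card_inf_ker_mul_card_map f K, mul_comm]
    congr 2
    · rw [← map_inf_eq_map_inf_comap, inf_eq_right.2 hW]
    · congr 2
      ext y
      simp only [K, f, mem_inf, mem_torsionBy_iff, mem_comap, LinearMap.mem_ker,
        LinearMap.lsmul_apply]
      refine ⟨fun h => h.2, fun h => ⟨⟨?_, ?_⟩, h⟩⟩
      · rw [pow_succ', mul_smul, h, smul_zero]
      · rw [h]; exact W.zero_mem
  have hsplit : Nat.card (torsionBy R M (π ^ (a + 1))) =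
      Nat.card K + Nat.card {y : M // π ^ (a + 1) • y = 0 ∧ π ^ a • y ∉ W} := by
    classical
    rw [← Nat.card_sum]
    refine Nat.card_congr ((Equiv.sumCompl
      (fun y : torsionBy R M (π ^ (a + 1)) => π ^ a • (y : M) ∈ W)).symm.trans (Equiv.sumCongr ?_ ?_))
    · exact Equiv.subtypeSubtypeEquivSubtypeInter (fun y => π ^ (a + 1) • y = 0) (fun y => π ^ a • y ∈ W)
    · exact Equiv.subtypeSubtypeEquivSubtypeInter (fun y => π ^ (a + 1) • y = 0) (fun y => π ^ a • y ∉ W)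
  rw [hsplit, ← Nat.cast_mul, ← hK]
  push_cast
  ring

theorem natCard_socleIndependent (hR : IsFiniteChainRing R π q s) [Finite M] {m : ℕ}
    {l : Fin m → ℕ} (hl : ∀ j, l j < s) (hmono : Monotone l) :
    (Nat.card {x : Fin m → M // SocleIndependent π s l x} : ℚ) =
      ∏ j : Fin m, ((Nat.card (torsionBy R M (π ^ (s - l j))) : ℚ) -
        (q : ℚ) ^ (j : ℕ) * Nat.card (torsionBy R M (π ^ (s - 1 - l j)))) := by
  induction m with
  | zero =>
    have : Unique {x : Fin 0 → M // SocleIndependent π s l x} :=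
      { default := ⟨Fin.elim0, by simp [SocleIndependent]⟩
        uniq := fun _ => Subsingleton.elim _ _ }
    simp
  | succ m ih =>
    have e : {x : Fin (m + 1) → M // SocleIndependent π s l x} ≃
        Σ x : {x : Fin m → M // SocleIndependent π s (fun j => l j.castSucc) x},
          {y : M // π ^ (s - l (Fin.last m)) • y = 0 ∧ π ^ (s - 1 - l (Fin.last m)) • y ∉
            span R (Set.range fun j : Fin m => π ^ (s - 1 - l j.castSucc) • x.1 j)} :=
      { toFun := fun x =>
          have h := (hR.socleIndependent_snoc hl (Fin.init (α := fun _ => M) x.1)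
            (x.1 (Fin.last m))).1 (by rw [Fin.snoc_init_self]; exact x.2)
          ⟨⟨Fin.init (α := fun _ => M) x.1, h.1⟩, ⟨x.1 (Fin.last m), h.2⟩⟩
        invFun := fun p => ⟨Fin.snoc (α := fun _ => M) p.1.1 p.2.1,
          (hR.socleIndependent_snoc hl p.1.1 p.2.1).2 ⟨p.1.2, p.2.2⟩⟩
        left_inv := fun x => Subtype.ext (Fin.snoc_init_self x.1)
        right_inv := by
          rintro ⟨⟨x, hx⟩, ⟨y, hy⟩⟩
          refine Sigma.subtype_ext (Subtype.ext ?_) ?_ <;> simp }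
    have := Fintype.ofFinite {x : Fin m → M // SocleIndependent π s (fun j => l j.castSucc) x}
    rw [Nat.card_congr e, Nat.card_sigma, Nat.cast_sum, Fin.prod_univ_castSucc]
    simp only [Fin.val_castSucc, Fin.val_last]
    rw [← ih (l := fun j => l j.castSucc) (fun j => hl _) (fun i j hij => hmono (Fin.castSucc_le_castSucc_iff.2 hij))]
    rw [Nat.card_eq_fintype_card, ← nsmul_eq_mul, ← Finset.card_univ]
    refine Finset.sum_eq_card_nsmul fun x _ => ?_
    have hlast := hl (Fin.last m)
    have ha : s - l (Fin.last m) = s - 1 - l (Fin.last m) + 1 := by omega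
    have htor : ∀ j : Fin m, π • π ^ (s - 1 - l j.castSucc) • x.1 j = 0 := by
      intro j
      have := hl j.castSucc
      rw [smul_smul, ← pow_succ', show s - 1 - l j.castSucc + 1 = s - l j.castSucc by omega]
      exact x.2.1 j
    rw [ha, natCard_torsionBy_sub, hR.natCard_span_of_independent htor x.2.2]
    · simp
    · rw [span_le]
      rintro _ ⟨j, rfl⟩
      -- Monotonicity is needed here: earlier entries have lower level, so their socle vectors are
      -- divisible by the power of π required at the last level.
      have hj : l j.castSucc ≤ l (Fin.last m) := hmono (Fin.le_last _)
      refine ⟨π ^ (l (Fin.last m) - l j.castSucc) • x.1 j, ?_, ?_⟩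
      · rw [SetLike.mem_coe, mem_torsionBy_iff, smul_smul, ← pow_add, ← ha,
          show s - l (Fin.last m) + (l (Fin.last m) - l j.castSucc) = s - l j.castSucc by omega]
        exact x.2.1 j
      · rw [LinearMap.lsmul_apply, smul_smul, ← pow_add]
        congr 2
        omega

end IsFiniteChainRing

/-! ### Injections from, and generating tuples of, chain modules -/

/-- The module `⟨π ^ l 0⟩ × ⋯ × ⟨π ^ l (m - 1)⟩`. -/
def chainModule {R : Type*} [CommRing R] (π : R) {m : ℕ} (l : Fin m → ℕ) :
    Submodule R (Fin m → R) :=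
  Submodule.pi Set.univ fun j => Ideal.span {π ^ l j}

namespace chainModule

open Submodule

variable {R M : Type*} [CommRing R] [AddCommGroup M] [Module R M] {π : R} {q s m : ℕ}
  {l : Fin m → ℕ}

theorem mem_iff {y : Fin m → R} : y ∈ chainModule π l ↔ ∀ j, π ^ l j ∣ y j := by
  simp [chainModule, mem_pi, Ideal.mem_span_singleton]

/-- The `j`-th standard generator, with the entry `π ^ l j` in position `j`. -/
def gen (π : R) (l : Fin m → ℕ) (j : Fin m) : chainModule π l :=
  ⟨Pi.single j (π ^ l j), mem_iff.2 fun i => by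
    by_cases h : i = j
    · subst h; simp
    · simp [h]⟩

theorem coe_sum_smul_gen (c : Fin m → R) (j : Fin m) :
    ((∑ i, c i • gen π l i : chainModule π l) : Fin m → R) j = c j * π ^ l j := by
  simp [gen, Finset.sum_apply, Pi.single_apply]

theorem exists_eq_sum (y : chainModule π l) : ∃ c : Fin m → R, y = ∑ j, c j • gen π l j := by
  choose c hc using mem_iff.1 y.2
  exact ⟨c, Subtype.ext (funext fun j => by rw [coe_sum_smul_gen, hc, mul_comm])⟩

theorem hom_ext {f g : chainModule π l →ₗ[R] M} (h : ∀ j, f (gen π l j) = g (gen π l j)) :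
    f = g := by
  ext y
  obtain ⟨c, rfl⟩ := exists_eq_sum y
  simp [h]

theorem sum_smul_gen_eq_zero_iff (hR : IsFiniteChainRing R π q s) {c : Fin m → R} :
    ∑ j, c j • gen π l j = 0 ↔ ∀ j, π ^ (s - l j) ∣ c j := by
  rw [Subtype.ext_iff, funext_iff]
  refine forall_congr' fun j => ?_
  rw [coe_sum_smul_gen, mul_comm, ← hR.pow_mul_eq_zero_iff]
  rfl

theorem pow_smul_gen (hR : IsFiniteChainRing R π q s) (j : Fin m) :
    π ^ (s - l j) • gen π l j = 0 := by
  refine Subtype.ext (funext fun i => ?_)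
  by_cases h : i = j
  · subst h
    simp [gen, ← pow_add, hR.pow_eq_zero_iff.2 (show s ≤ s - l i + l i by omega)]
  · simp [gen, h]

/-- The relations among the generators are exactly those forced by π^(s - l j) • gen j = 0, so the
map R^m → M given by x factors through the chain module. -/
theorem exists_hom (hR : IsFiniteChainRing R π q s) {x : Fin m → M}
    (hx : ∀ j, π ^ (s - l j) • x j = 0) :
    ∃ f : chainModule π l →ₗ[R] M, ∀ j, f (gen π l j) = x j := by
  classical
  set G := Fintype.linearCombination R (gen π l)
  have hG : Function.Surjective G := fun y => by
    obtain ⟨c, rfl⟩ := exists_eq_sum y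
    exact ⟨c, rfl⟩
  have hker : LinearMap.ker G ≤ LinearMap.ker (Fintype.linearCombination R x) := by
    intro c hc
    rw [LinearMap.mem_ker, Fintype.linearCombination_apply] at hc ⊢
    refine Finset.sum_eq_zero fun j _ => ?_
    obtain ⟨d, hd⟩ := (sum_smul_gen_eq_zero_iff hR).1 hc j
    rw [hd, mul_comm, mul_smul, hx, smul_zero]
  refine ⟨(LinearMap.ker G).liftQ _ hker ∘ₗ (G.quotKerEquivOfSurjective hG).symm.toLinearMap,
    fun j => ?_⟩
  have hj : gen π l j = G (Pi.single j 1) := by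
    simp [G, Fintype.linearCombination_apply_single]
  have hsymm : (G.quotKerEquivOfSurjective hG).symm (G (Pi.single j 1)) =
      Submodule.Quotient.mk (Pi.single j 1) := by
    rw [LinearEquiv.symm_apply_eq]
    rfl
  rw [LinearMap.comp_apply, hj, LinearEquiv.coe_coe, hsymm]
  simp [Fintype.linearCombination_apply_single]

theorem sum_pow_smul_gen_eq_zero_iff (hR : IsFiniteChainRing R π q s) (hl : ∀ j, l j < s)
    {c : Fin m → R} :
    ∑ j, c j • π ^ (s - 1 - l j) • gen π l j = 0 ↔ ∀ j, π ∣ c j := by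
  simp only [smul_smul]
  rw [sum_smul_gen_eq_zero_iff hR]
  refine forall_congr' fun j => ?_
  have := hl j
  rw [← hR.pow_mul_eq_zero_iff, mul_comm (c j), ← mul_assoc, ← pow_add, mul_comm,
    show l j + (s - 1 - l j) = s - 1 by omega, hR.mul_pow_pred_eq_zero_iff]

/-- Since π is nilpotent, a nonzero kernel contains a nonzero element killed by π. The elements
killed by π are the combinations of the π^(s-1-l j) • gen j. -/
theorem injective_iff (hR : IsFiniteChainRing R π q s) (hl : ∀ j, l j < s)
    (f : chainModule π l →ₗ[R] M) :
    Function.Injective f ↔ SocleIndependent π s l fun j => f (gen π l j) := by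
  have hf : ∀ c : Fin m → R, ∑ j, c j • π ^ (s - 1 - l j) • f (gen π l j) =
      f (∑ j, c j • π ^ (s - 1 - l j) • gen π l j) := by simp
  constructor
  · refine fun hinj => ⟨fun j => ?_, fun c hc => ?_⟩
    · rw [← map_smul, pow_smul_gen hR, map_zero]
    · rw [hf, map_eq_zero_iff f hinj] at hc
      exact (sum_pow_smul_gen_eq_zero_iff hR hl).1 hc
  · rintro ⟨-, hind⟩
    have socle : ∀ y, π • y = 0 → f y = 0 → y = 0 := by
      intro y hy hfy
      have hdvd : ∀ j, ∃ c, (y : Fin m → R) j = π ^ (s - 1) * c := fun j => by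
        have := congr_fun (congr_arg Subtype.val hy) j
        have h1 := hR.pow_mul_eq_zero_iff (a := 1) (x := (y : Fin m → R) j)
        rw [pow_one] at h1
        exact h1.1 this
      choose c hc using hdvd
      have hyc : y = ∑ j, c j • π ^ (s - 1 - l j) • gen π l j := by
        simp only [smul_smul]
        refine Subtype.ext (funext fun j => ?_)
        have := hl j
        rw [coe_sum_smul_gen, hc, mul_assoc, ← pow_add, mul_comm,
          show s - 1 - l j + l j = s - 1 by omega]
      rw [hyc, ← hf] at hfy
      rw [hyc, sum_pow_smul_gen_eq_zero_iff hR hl]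
      exact hind c hfy
    rw [← LinearMap.ker_eq_bot, LinearMap.ker_eq_bot']
    have key : ∀ k y, π ^ k • y = 0 → f y = 0 → y = 0 := by
      intro k
      induction k with
      | zero => intro y hy _; simpa using hy
      | succ k ih =>
        intro y hy hfy
        rw [pow_succ, mul_smul] at hy
        exact socle y (ih (π • y) hy (by rw [map_smul, hfy, smul_zero])) hfy
    exact fun y => key s y (by rw [hR.pow_eq_zero_iff.2 le_rfl, zero_smul])

theorem natCard_injective (hR : IsFiniteChainRing R π q s) (hl : ∀ j, l j < s) :
    Nat.card {f : chainModule π l →ₗ[R] M // Function.Injective f} =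
      Nat.card {x : Fin m → M // SocleIndependent π s l x} := by
  refine Nat.card_congr (Equiv.ofBijective
    (fun f => ⟨fun j => f.1 (gen π l j), (injective_iff hR hl f.1).1 f.2⟩) ⟨fun f g h => ?_, ?_⟩)
  · exact Subtype.ext (hom_ext fun j => congr_fun (congr_arg Subtype.val h) j)
  · rintro ⟨x, hx⟩
    obtain ⟨f, hf⟩ := exists_hom hR hx.1
    refine ⟨⟨f, (injective_iff hR hl f).2 ?_⟩, Subtype.ext (funext hf)⟩
    simpa only [hf] using hx

/-- Enlarge N to a maximal submodule; the simple quotient is R/⟨π⟩, which embeds in R by 1 ↦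
π^(s-1). -/
theorem exists_functional_of_ne_top (hR : IsFiniteChainRing R π q s) [Finite M]
    {N : Submodule R M} (hN : N ≠ ⊤) :
    ∃ f : M →ₗ[R] R, f ≠ 0 ∧ N ≤ LinearMap.ker f ∧ ∀ y, π * f y = 0 := by
  obtain ⟨N', hN', hle⟩ := (eq_top_or_exists_le_coatom N).resolve_left hN
  obtain ⟨I, hI, ⟨e⟩⟩ := isSimpleModule_iff_quot_maximal.1 (isSimpleModule_iff_isCoatom.2 hN')
  rw [hR.eq_span_of_isMaximal hI] at e
  set g : R →ₗ[R] R := LinearMap.toSpanSingleton R R (π ^ (s - 1))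
  have hker : Ideal.span {π} = LinearMap.ker g := by
    ext x
    rw [LinearMap.mem_ker, LinearMap.toSpanSingleton_apply, smul_eq_mul,
      hR.mul_pow_pred_eq_zero_iff, Ideal.mem_span_singleton]
  set h : (R ⧸ Ideal.span {π}) →ₗ[R] R := (Ideal.span {π}).liftQ g hker.le
  have hh : Function.Injective h := by
    rw [← LinearMap.ker_eq_bot]
    exact ker_liftQ_eq_bot' _ _ hker
  have hf : ∀ y, (h ∘ₗ e.toLinearMap ∘ₗ N'.mkQ) y = 0 ↔ y ∈ N' := by
    intro y
    rw [LinearMap.comp_apply, map_eq_zero_iff h hh, LinearMap.comp_apply, LinearEquiv.coe_coe,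
      map_eq_zero_iff e e.injective, mkQ_apply, Submodule.Quotient.mk_eq_zero]
  refine ⟨h ∘ₗ e.toLinearMap ∘ₗ N'.mkQ, fun h0 => hN'.1 ?_, fun y hy => (hf y).2 (hle hy),
    fun y => ?_⟩
  · rw [eq_top_iff]
    exact fun y _ => (hf y).1 (by rw [h0]; rfl)
  · rw [LinearMap.comp_apply]
    obtain ⟨r, hr⟩ := Submodule.Quotient.mk_surjective _ ((e.toLinearMap ∘ₗ N'.mkQ) y)
    rw [← hr, ← smul_eq_mul, ← map_smul, ← Submodule.Quotient.mk_smul,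
      (Submodule.Quotient.mk_eq_zero _).2, map_zero]
    exact Ideal.mul_mem_right _ _ (Ideal.mem_span_singleton_self _)

/-- The functionals on the chain module with values killed by π are y ↦ ∑ c_j π^(s-1-l j) y_j, and
such a functional is zero iff π divides every c_j. Vanishing on all rows x i is a linear relation
between the columns. -/
theorem span_range_eq_top_iff (hR : IsFiniteChainRing R π q s) (hl : ∀ j, l j < s) {n : ℕ}
    (x : Fin n → chainModule π l) :
    span R (Set.range x) = ⊤ ↔
      SocleIndependent π s l fun (j : Fin m) (i : Fin n) => (x i : Fin m → R) j := by
  have := hR.finite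
  have hpow : ∀ j, s - 1 - l j + l j = s - 1 := fun j => by have := hl j; omega
  constructor
  · refine fun hspan => ⟨fun j => funext fun i => hR.pow_mul_eq_zero_iff.2 ?_, fun c hc j => ?_⟩
    · rw [show s - (s - l j) = l j by have := hl j; omega]
      exact mem_iff.1 (x i).2 j
    · set f : chainModule π l →ₗ[R] R :=
        ∑ j, c j • π ^ (s - 1 - l j) • (LinearMap.proj j ∘ₗ (chainModule π l).subtype) with hfdef
      have hf : ∀ y : chainModule π l,
          f y = ∑ j, c j • π ^ (s - 1 - l j) • (y : Fin m → R) j := fun y => by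
        simp [hfdef]
      have h0 : (⊤ : Submodule R (chainModule π l)) ≤ LinearMap.ker f := by
        rw [← hspan, span_le]
        rintro _ ⟨i, rfl⟩
        have := congr_fun hc i
        rw [SetLike.mem_coe, LinearMap.mem_ker, hf]
        simpa using this
      -- Evaluating at the j-th generator isolates c_j π^(s-1).
      have := h0 (mem_top (x := gen π l j))
      rw [LinearMap.mem_ker, hf, Finset.sum_eq_single j] at this
      · simp only [gen, Pi.single_eq_same, smul_eq_mul] at this
        rwa [← pow_add, hpow, hR.mul_pow_pred_eq_zero_iff] at this
      · intro i _ hi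
        simp [gen, hi]
      · simp
  · rintro ⟨-, hind⟩
    by_contra hspan
    obtain ⟨f, hf0, hker, hπ⟩ := exists_functional_of_ne_top hR hspan
    have hdvd : ∀ j, ∃ c, f (gen π l j) = π ^ (s - 1) * c := fun j => by
      have h1 := hR.pow_mul_eq_zero_iff (a := 1) (x := f (gen π l j))
      rw [pow_one] at h1
      exact h1.1 (hπ _)
    choose c hc using hdvd
    have hf : ∀ y : chainModule π l,
        f y = ∑ j, c j • π ^ (s - 1 - l j) • (y : Fin m → R) j := fun y => by
      obtain ⟨d, rfl⟩ := exists_eq_sum y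
      rw [map_sum]
      refine Finset.sum_congr rfl fun j _ => ?_
      rw [map_smul, coe_sum_smul_gen, hc,
        show π ^ (s - 1) = π ^ (s - 1 - l j) * π ^ l j by rw [← pow_add, hpow]]
      simp only [smul_eq_mul]
      ring
    apply hf0
    refine hom_ext fun j => ?_
    obtain ⟨d, hd⟩ := hind c (funext fun i => by
      have := hker (subset_span ⟨i, rfl⟩)
      rw [LinearMap.mem_ker, hf] at this
      simpa using this) j
    rw [hc, hd, LinearMap.zero_apply, mul_comm, mul_comm π, mul_assoc, mul_comm π, ← pow_succ]
    rw [hR.pow_eq_zero_iff.2 (by omega), mul_zero]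

theorem natCard_span_range_eq_top (hR : IsFiniteChainRing R π q s) (hl : ∀ j, l j < s) (n : ℕ) :
    Nat.card {x : Fin n → chainModule π l // span R (Set.range x) = ⊤} =
      Nat.card {x : Fin m → Fin n → R // SocleIndependent π s l x} := by
  refine Nat.card_congr
    { toFun := fun x => ⟨fun j i => (x.1 i : Fin m → R) j, (span_range_eq_top_iff hR hl x.1).1 x.2⟩
      invFun := fun x => ⟨fun i => ⟨fun j => x.1 j i, ?_⟩, ?_⟩
      left_inv := fun _ => rfl
      right_inv := fun _ => rfl }
  · refine mem_iff.2 fun j => ?_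
    have h := hR.pow_mul_eq_zero_iff.1 (congr_fun (x.2.1 j) i)
    rwa [show s - (s - l j) = l j by have := hl j; omega] at h
  · exact (span_range_eq_top_iff hR hl _).2 x.2

end chainModule

/-! ### Sorting injections and tuples by the submodule they produce -/

section CountByImage

open Submodule

variable {R M P : Type*} [CommRing R] [AddCommGroup M] [Module R M] [AddCommGroup P] [Module R P]

theorem natCard_injective_eq_card_submodules_mul [Finite M] [Finite P] :
    Nat.card {f : P →ₗ[R] M // Function.Injective f} =
      Nat.card {N : Submodule R M // Nonempty (N ≃ₗ[R] P)} *
        Nat.card {f : P →ₗ[R] P // Function.Injective f} := by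
  classical
  -- Compares values in M, so that equality of the dependent pairs needs no transport along equality
  -- of submodules.
  have hext : ∀ {p r : Σ N : {N : Submodule R M // Nonempty (N ≃ₗ[R] P)}, (P ≃ₗ[R] N.1)},
      p.1.1 = r.1.1 → (∀ x, (p.2 x : M) = r.2 x) → p = r := by
    rintro ⟨⟨N, hN⟩, g⟩ ⟨⟨N', hN'⟩, g'⟩ h hx
    dsimp only at h
    subst h
    congr 1
    exact LinearEquiv.ext fun x => Subtype.ext (hx x)
  have e : {f : P →ₗ[R] M // Function.Injective f} ≃
      Σ N : {N : Submodule R M // Nonempty (N ≃ₗ[R] P)}, (P ≃ₗ[R] N.1) :=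
    { toFun := fun f => ⟨⟨LinearMap.range f.1, ⟨(LinearEquiv.ofInjective f.1 f.2).symm⟩⟩,
        LinearEquiv.ofInjective f.1 f.2⟩
      invFun := fun p => ⟨p.1.1.subtype ∘ₗ p.2.toLinearMap,
        p.1.1.injective_subtype.comp p.2.injective⟩
      left_inv := fun f => rfl
      right_inv := by
        rintro ⟨⟨N, hN⟩, g⟩
        have h : LinearMap.range (N.subtype ∘ₗ g.toLinearMap) = N := by
          rw [LinearMap.range_comp, LinearEquiv.range, Submodule.map_top, Submodule.range_subtype]
        exact hext h fun _ => rfl }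
  -- Injective endomorphisms of the finite module P are automorphisms, so every fibre has the same
  -- size.
  have e2 : ∀ N : {N : Submodule R M // Nonempty (N ≃ₗ[R] P)},
      Nat.card (P ≃ₗ[R] N.1) = Nat.card {f : P →ₗ[R] P // Function.Injective f} := fun N =>
    Nat.card_congr
      { toFun := fun g => ⟨(g.trans N.2.some).toLinearMap, (g.trans N.2.some).injective⟩
        invFun := fun f => (LinearEquiv.ofBijective f.1
          (Finite.injective_iff_bijective.1 f.2)).trans N.2.some.symm
        left_inv := fun g => by ext; simp
        right_inv := fun f => by ext; simp }
  have := Fintype.ofFinite {N : Submodule R M // Nonempty (N ≃ₗ[R] P)}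
  have (N : {N : Submodule R M // Nonempty (N ≃ₗ[R] P)}) : Finite (P ≃ₗ[R] N.1) :=
    Finite.of_injective (fun g => (g : P → N.1)) DFunLike.coe_injective
  rw [Nat.card_congr e, Nat.card_sigma, Finset.sum_congr rfl fun N _ => e2 N, Finset.sum_const,
    Finset.card_univ, Nat.card_eq_fintype_card (α := {N : Submodule R M // Nonempty (N ≃ₗ[R] P)}),
    smul_eq_mul]

theorem natCard_tuples_eq_card_submodules_mul [Finite M] (ι : Type*) [Finite ι] :
    Nat.card {x : ι → M // Nonempty (span R (Set.range x) ≃ₗ[R] P)} =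
      Nat.card {N : Submodule R M // Nonempty (N ≃ₗ[R] P)} *
        Nat.card {x : ι → P // span R (Set.range x) = ⊤} := by
  have hspan : ∀ (N : Submodule R M) (y : ι → N),
      span R (Set.range y) = ⊤ ↔ span R (Set.range fun i => (y i : M)) = N := by
    intro N y
    rw [← (map_injective_of_injective N.injective_subtype).eq_iff, map_subtype_top, map_span,
      ← Set.range_comp]
    rfl
  have e : {x : ι → M // Nonempty (span R (Set.range x) ≃ₗ[R] P)} ≃
      Σ N : {N : Submodule R M // Nonempty (N ≃ₗ[R] P)},
        {x : ι → M // span R (Set.range x) = N.1} :=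
    { toFun := fun x => ⟨⟨span R (Set.range x.1), x.2⟩, ⟨x.1, rfl⟩⟩
      invFun := fun p => ⟨p.2.1, by rw [p.2.2]; exact p.1.2⟩
      left_inv := fun _ => rfl
      right_inv := by
        rintro ⟨⟨N, hN⟩, ⟨x, hx⟩⟩
        dsimp only at hx
        subst hx
        rfl }
  have e2 : ∀ N : {N : Submodule R M // Nonempty (N ≃ₗ[R] P)},
      Nat.card {x : ι → M // span R (Set.range x) = N.1} =
        Nat.card {x : ι → P // span R (Set.range x) = ⊤} := by
    rintro ⟨N, ⟨g⟩⟩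
    have h : ∀ y : ι → N, span R (Set.range fun i => g (y i)) = ⊤ ↔ span R (Set.range y) = ⊤ := by
      intro y
      rw [← (map_injective_of_injective (f := g.toLinearMap) g.injective).eq_iff, map_span,
        ← Set.range_comp, Submodule.map_top, LinearEquiv.range]
      rfl
    refine Nat.card_congr
      { toFun := fun x => ⟨fun i => g ⟨x.1 i, ?_⟩, (h _).2 ((hspan N _).2 x.2)⟩
        invFun := fun y => ⟨fun i => (g.symm (y.1 i) : N), ?_⟩
        left_inv := fun x => by simp
        right_inv := fun y => by simp }
    · exact x.2.le (subset_span ⟨i, rfl⟩)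
    · rw [← hspan, ← h]
      simpa using y.2
  have := Fintype.ofFinite {N : Submodule R M // Nonempty (N ≃ₗ[R] P)}
  rw [Nat.card_congr e, Nat.card_sigma, Finset.sum_congr rfl fun N _ => e2 N, Finset.sum_const,
    Finset.card_univ, Nat.card_eq_fintype_card (α := {N : Submodule R M // Nonempty (N ≃ₗ[R] P)}),
    smul_eq_mul]

end CountByImage

/-! ### Matrices as tuples of rows -/

theorem natCard_shapedMatrices {R : Type*} [CommRing R] (π : R) {s : ℕ} (n : ℕ)
    (μ : ChainShape s) :
    Nat.card (shapedMatrices π n μ) = Nat.card (shapeModule π μ) ^ n := by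
  rw [show Nat.card (shapeModule π μ) ^ n = Nat.card (Fin n → shapeModule π μ) by
    rw [Nat.card_fun, Nat.card_fin]]
  exact Nat.card_congr
    { toFun := fun A i => ⟨A.1.row i, A.2 i⟩
      invFun := fun x => ⟨Matrix.of fun i => (x i).1, fun i => (x i).2⟩
      left_inv := fun _ => rfl
      right_inv := fun _ => rfl }

theorem natCard_shapedMatricesOfShape {R : Type*} [CommRing R] [Finite R] (π : R) {s : ℕ} (n : ℕ)
    (μ κ : ChainShape s) :
    Nat.card (shapedMatricesOfShape π n μ κ) =
      Nat.card {N : Submodule R (shapeModule π μ) // HasShape π N κ} *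
        Nat.card {x : Fin n → shapeModule π κ // Submodule.span R (Set.range x) = ⊤} := by
  have h := natCard_tuples_eq_card_submodules_mul (R := R) (M := shapeModule π μ)
    (P := shapeModule π κ) (Fin n)
  refine Eq.trans ?_ h
  have hspan : ∀ x : Fin n → shapeModule π μ, Nonempty (Submodule.span R (Set.range x) ≃ₗ[R]
      Submodule.span R (Set.range fun i => (x i : Fin (μ.comp s) → R))) := by
    intro x
    have hmap : (Submodule.span R (Set.range x)).map (shapeModule π μ).subtype =
        Submodule.span R (Set.range fun i => (x i : Fin (μ.comp s) → R)) := by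
      rw [Submodule.map_span, ← Set.range_comp]
      rfl
    exact ⟨(Submodule.equivMapOfInjective _ (shapeModule π μ).injective_subtype _).trans
      (LinearEquiv.ofEq _ _ hmap)⟩
  exact Nat.card_congr
    { toFun := fun A => ⟨fun i => ⟨A.1.row i, A.2.1 i⟩,
        (hspan fun i => ⟨A.1.row i, A.2.1 i⟩).map2 LinearEquiv.trans A.2.2⟩
      invFun := fun x => ⟨Matrix.of fun i => (x.1 i).1, fun i => (x.1 i).2,
        (hspan x.1).map2 (fun e f => e.symm.trans f) x.2⟩
      left_inv := fun _ => rfl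
      right_inv := fun _ => rfl }

/-! ### Sizes of chain modules and of their torsion -/

namespace chainModule

open Submodule

variable {R : Type*} [CommRing R] {π : R} {q s m : ℕ} {l : Fin m → ℕ}

theorem natCard_eq (hR : IsFiniteChainRing R π q s) :
    Nat.card (chainModule π l) = ∏ j, q ^ (s - l j) := by
  simp only [← hR.natCard_span_pow]
  rw [← Nat.card_pi]
  exact Nat.card_congr
    { toFun := fun y j => ⟨y.1 j, y.2 j (Set.mem_univ j)⟩
      invFun := fun y => ⟨fun j => (y j).1, fun j _ => (y j).2⟩
      left_inv := fun _ => rfl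
      right_inv := fun _ => rfl }

/-- An entry is killed by π^t iff π^(s-t) divides it, so the torsion is again a chain module, with
levels max (l j) (s - t). -/
theorem natCard_torsionBy (hR : IsFiniteChainRing R π q s) (t : ℕ) :
    Nat.card (torsionBy R (chainModule π l) (π ^ t)) = ∏ j, q ^ min (s - l j) t := by
  have hsup : ∀ y : Fin m → R, y ∈ chainModule π (fun j => max (l j) (s - t)) ↔
      y ∈ chainModule π l ∧ π ^ t • y = 0 := by
    intro y
    rw [mem_iff, mem_iff, funext_iff, ← forall_and]
    refine forall_congr' fun j => ?_
    rw [Pi.smul_apply, smul_eq_mul, Pi.zero_apply, hR.pow_mul_eq_zero_iff]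
    refine ⟨fun h => ⟨(pow_dvd_pow _ (le_max_left _ _)).trans h,
      (pow_dvd_pow _ (le_max_right _ _)).trans h⟩, fun h => ?_⟩
    rcases max_choice (l j) (s - t) with h' | h' <;> rw [h']
    exacts [h.1, h.2]
  have e : torsionBy R (chainModule π l) (π ^ t) ≃
      chainModule π (fun j => max (l j) (s - t)) :=
    { toFun := fun y => ⟨y.1.1, (hsup _).2 ⟨y.1.2, congr_arg Subtype.val y.2⟩⟩
      invFun := fun y => ⟨⟨y.1, ((hsup _).1 y.2).1⟩, Subtype.ext ((hsup _).1 y.2).2⟩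
      left_inv := fun _ => rfl
      right_inv := fun _ => rfl }
  rw [Nat.card_congr e, natCard_eq hR]
  refine Finset.prod_congr rfl fun j _ => ?_
  rcases le_total s t with h | h
  · congr 1; omega
  · congr 1; omega

end chainModule

theorem IsFiniteChainRing.natCard_torsionBy_fin {R : Type*} [CommRing R] {π : R} {q s : ℕ}
    (hR : IsFiniteChainRing R π q s) (n : ℕ) {t : ℕ} (ht : t ≤ s) :
    Nat.card (Submodule.torsionBy R (Fin n → R) (π ^ t)) = (q ^ t) ^ n := by
  have h : Submodule.torsionBy R (Fin n → R) (π ^ t) = chainModule π fun _ => s - t := by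
    ext y
    rw [Submodule.mem_torsionBy_iff, chainModule.mem_iff, funext_iff]
    exact forall_congr' fun j => hR.pow_mul_eq_zero_iff
  rw [h, chainModule.natCard_eq hR, Finset.prod_const, Finset.card_univ, Fintype.card_fin,
    Nat.sub_sub_self ht]

/-! ### Combinatorics of shapes -/

namespace ChainShape

variable {s : ℕ} (μ : ChainShape s)

@[simp]
theorem comp_zero : μ.comp 0 = 0 := rfl

theorem comp_succ {i : ℕ} (hi : i < s) : μ.comp (i + 1) = μ.parts ⟨i, hi⟩ := dif_pos hi

theorem comp_le_comp {i j : ℕ} (hij : i ≤ j) (hj : j ≤ s) : μ.comp i ≤ μ.comp j := by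
  rcases i with _ | i
  · simp
  · rcases j with _ | j
    · omega
    · rw [comp_succ μ (by omega), comp_succ μ (by omega)]
      exact μ.mono (Fin.mk_le_mk.2 (by omega))

theorem level_le_iff {i : ℕ} (hi : i < s) (j : ℕ) : μ.level j ≤ i ↔ j < μ.comp (i + 1) := by
  rw [comp_succ μ hi, level]
  constructor
  · intro h
    by_contra! hj
    have hsub : Finset.Iic (⟨i, hi⟩ : Fin s) ⊆
        Finset.univ.filter fun i : Fin s => μ.parts i ≤ j := fun k hk => by
      simpa using (μ.mono (Finset.mem_Iic.1 hk)).trans hj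
    have := Finset.card_le_card hsub
    rw [Fin.card_Iic] at this
    simp only at this
    omega
  · intro hj
    have hsub : (Finset.univ.filter fun i : Fin s => μ.parts i ≤ j) ⊆
        Finset.Iio (⟨i, hi⟩ : Fin s) := fun k hk => by
      rw [Finset.mem_filter] at hk
      rw [Finset.mem_Iio]
      by_contra! h
      exact absurd (μ.mono h) (by omega)
    have := Finset.card_le_card hsub
    rwa [Fin.card_Iio] at this

theorem level_lt {j : ℕ} (hj : j < μ.comp s) : μ.level j < s := by
  rcases s with _ | s
  · simp at hj
  · exact Nat.lt_succ_of_le ((μ.level_le_iff (Nat.lt_succ_self s) j).2 hj)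

theorem level_mono : Monotone μ.level := fun _ _ h =>
  Finset.card_le_card (Finset.monotone_filter_right _ fun _ _ hi => hi.trans h)

theorem level_eq {i j : ℕ} (hi : i < s) (h1 : μ.comp i ≤ j) (h2 : j < μ.comp (i + 1)) :
    μ.level j = i := by
  refine le_antisymm ((μ.level_le_iff hi j).2 h2) ?_
  rcases i with _ | i
  · simp
  · have := (μ.level_le_iff (i := i) (by omega) j).not.2 (by omega)
    omega

/-- Double counting of the pairs (j, i) with s - t ≤ i < s and level of j at most i; for fixed i
these j are the first μ_{i+1} coordinates. -/
theorem sum_min_level {t : ℕ} (ht : t ≤ s) :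
    ∑ j : Fin (μ.comp s), min (s - μ.level j) t = ∑ i ∈ Finset.Ico (s - t) s, μ.comp (i + 1) := by
  have h1 : ∀ j : Fin (μ.comp s), min (s - μ.level j) t =
      ∑ i ∈ Finset.Ico (s - t) s, if μ.level j ≤ i then 1 else 0 := by
    intro j
    have hj := μ.level_lt j.2
    have : (Finset.Ico (s - t) s).filter (fun i => μ.level j ≤ i) =
        Finset.Ico (max (s - t) (μ.level j)) s := by
      ext i
      simp only [Finset.mem_filter, Finset.mem_Ico]
      omega
    rw [Finset.sum_boole, this, Nat.card_Ico, Nat.cast_id]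
    omega
  simp only [h1]
  rw [Finset.sum_comm]
  refine Finset.sum_congr rfl fun i hi => ?_
  rw [Finset.mem_Ico] at hi
  have hle := μ.comp_le_comp (show i + 1 ≤ s by omega) le_rfl
  have := Fin.sum_univ_eq_sum_range (fun j => if μ.level j ≤ i then 1 else 0) (μ.comp s)
  rw [this, Finset.sum_boole, Nat.cast_id]
  have : (Finset.range (μ.comp s)).filter (fun j => μ.level j ≤ i) =
      Finset.range (μ.comp (i + 1)) := by
    ext j
    rw [Finset.mem_filter, Finset.mem_range, Finset.mem_range, μ.level_le_iff hi.2]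
    omega
  rw [this, Finset.card_range]

theorem prod_level {A : Type*} [CommMonoid A] (F : ℕ → ℕ → A) :
    ∏ j : Fin (μ.comp s), F (μ.level j) j =
      ∏ i ∈ Finset.range s, ∏ j ∈ Finset.Ico (μ.comp i) (μ.comp (i + 1)), F i j := by
  have key : ∀ a ≤ s, ∏ j ∈ Finset.range (μ.comp a), F (μ.level j) j =
      ∏ i ∈ Finset.range a, ∏ j ∈ Finset.Ico (μ.comp i) (μ.comp (i + 1)), F i j := by
    intro a
    induction a with
    | zero => simp
    | succ a ih =>
      intro ha
      rw [Finset.prod_range_succ, ← ih (by omega),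
        ← Finset.prod_range_mul_prod_Ico _ (μ.comp_le_comp (Nat.le_succ a) ha)]
      congr 1
      refine Finset.prod_congr rfl fun j hj => ?_
      rw [Finset.mem_Ico] at hj
      rw [μ.level_eq ha hj.1 hj.2]
  rw [← key s le_rfl]
  exact Fin.prod_univ_eq_prod_range (fun j => F (μ.level j) j) _

/-- The number `μ_{a+1} + ⋯ + μ_s`. -/
def tailSum (a : ℕ) : ℕ := ∑ i ∈ Finset.Ico a s, μ.comp (i + 1)

end ChainShape

/-! ### Evaluation of the counts -/

theorem natCard_torsionBy_shapeModule {R : Type*} [CommRing R] {π : R} {q s : ℕ}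
    (hR : IsFiniteChainRing R π q s) (μ : ChainShape s) {t : ℕ} (ht : t ≤ s) :
    Nat.card (Submodule.torsionBy R (shapeModule π μ) (π ^ t)) = q ^ μ.tailSum (s - t) := by
  rw [ChainShape.tailSum, ← μ.sum_min_level ht, ← Finset.prod_pow_eq_pow_sum]
  exact chainModule.natCard_torsionBy hR t

theorem natCard_injective_shapeModule {R : Type*} [CommRing R] {π : R} {q s : ℕ}
    (hR : IsFiniteChainRing R π q s) (μ κ : ChainShape s) :
    (Nat.card {f : shapeModule π κ →ₗ[R] shapeModule π μ // Function.Injective f} : ℚ) =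
      ∏ i ∈ Finset.range s, ∏ j ∈ Finset.Ico (κ.comp i) (κ.comp (i + 1)),
        (q : ℚ) ^ μ.tailSum (i + 1) * ((q : ℚ) ^ μ.comp (i + 1) - (q : ℚ) ^ j) := by
  have := hR.finite
  have hl : ∀ j : Fin (κ.comp s), κ.level j < s := fun j => κ.level_lt j.2
  have h := chainModule.natCard_injective (M := shapeModule π μ) hR hl
  rw [← κ.prod_level fun i j =>
    (q : ℚ) ^ μ.tailSum (i + 1) * ((q : ℚ) ^ μ.comp (i + 1) - (q : ℚ) ^ j)]
  refine (congr_arg Nat.cast h).trans ?_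
  rw [hR.natCard_socleIndependent hl fun i j hij => κ.level_mono hij]
  refine Finset.prod_congr rfl fun j _ => ?_
  have hj := hl j
  rw [natCard_torsionBy_shapeModule hR μ (by omega), natCard_torsionBy_shapeModule hR μ (by omega),
    show s - (s - κ.level j) = κ.level j by omega,
    show s - (s - 1 - κ.level j) = κ.level j + 1 by omega]
  have htail : μ.tailSum (κ.level j) = μ.comp (κ.level j + 1) + μ.tailSum (κ.level j + 1) := by
    rw [ChainShape.tailSum, Finset.sum_eq_sum_Ico_succ_bot hj, ChainShape.tailSum]
  rw [htail]
  push_cast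
  ring

/-- Factor by factor, q^a cancels after shifting j by a. The integer exponent keeps this valid for μ
< a. -/
theorem gaussCoeff_mul_prod {q : ℕ} (hq : 1 < q) (μ a b : ℕ) (hab : a ≤ b) :
    gaussCoeff q ((μ : ℤ) - a) (b - a) * ∏ j ∈ Finset.Ico a b, ((q : ℚ) ^ b - (q : ℚ) ^ j) =
      ∏ j ∈ Finset.Ico a b, ((q : ℚ) ^ μ - (q : ℚ) ^ j) := by
  have hq0 : (q : ℚ) ≠ 0 := by positivity
  rw [gaussCoeff, Finset.prod_Ico_eq_prod_range, Finset.prod_Ico_eq_prod_range,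
    ← Finset.prod_mul_distrib]
  refine Finset.prod_congr rfl fun r hr => ?_
  rw [Finset.mem_range] at hr
  have hne : (q : ℚ) ^ (b - a) - (q : ℚ) ^ r ≠ 0 :=
    (sub_pos.2 (pow_lt_pow_right₀ (by exact_mod_cast hq) hr)).ne'
  have hb : (q : ℚ) ^ b = (q : ℚ) ^ a * (q : ℚ) ^ (b - a) := by
    rw [← pow_add, Nat.add_sub_cancel' hab]
  rw [zpow_sub₀ hq0, zpow_natCast, zpow_natCast, hb, pow_add, ← mul_sub, div_mul_eq_mul_div,
    div_eq_iff hne]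
  field_simp

/-- Summation by parts; it is applied with e = μ - κ (shifted by one) and c = κ to match the powers
of q. -/
theorem sum_tail_mul_sub (e c : ℕ → ℤ) (hc : c 0 = 0) (s : ℕ) :
    ∑ i ∈ Finset.range s, (∑ k ∈ Finset.Ico (i + 1) s, e k) * (c (i + 1) - c i) =
      ∑ i ∈ Finset.range s, e i * c i := by
  induction s with
  | zero => simp
  | succ s ih =>
    have h : ∀ i ∈ Finset.range s, (∑ k ∈ Finset.Ico (i + 1) (s + 1), e k) * (c (i + 1) - c i) =
        (∑ k ∈ Finset.Ico (i + 1) s, e k) * (c (i + 1) - c i) + e s * (c (i + 1) - c i) := by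
      intro i hi
      rw [Finset.mem_range] at hi
      rw [Finset.sum_Ico_succ_top (by omega), add_mul]
    rw [Finset.sum_range_succ, Finset.Ico_self, Finset.sum_empty, zero_mul, add_zero,
      Finset.sum_congr rfl h, Finset.sum_add_distrib, ih, ← Finset.mul_sum,
      Finset.sum_range_sub, hc, sub_zero, Finset.sum_range_succ]

/-- The two products are the numbers of injections R^κ → R^κ and R^κ → R^μ. The powers of q agree by
`sum_tail_mul_sub`, the remaining factors by `gaussCoeff_mul_prod`. -/
theorem shapeCoeff_mul_prod {q s : ℕ} (hq : 1 < q) (μ κ : ChainShape s) :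
    shapeCoeff q μ κ * ∏ i ∈ Finset.range s, ∏ j ∈ Finset.Ico (κ.comp i) (κ.comp (i + 1)),
        (q : ℚ) ^ κ.tailSum (i + 1) * ((q : ℚ) ^ κ.comp (i + 1) - (q : ℚ) ^ j) =
      ∏ i ∈ Finset.range s, ∏ j ∈ Finset.Ico (κ.comp i) (κ.comp (i + 1)),
        (q : ℚ) ^ μ.tailSum (i + 1) * ((q : ℚ) ^ μ.comp (i + 1) - (q : ℚ) ^ j) := by
  have hq0 : (q : ℚ) ≠ 0 := by positivity
  have hshape : shapeCoeff q μ κ = ∏ i ∈ Finset.range s,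
      (q : ℚ) ^ (((μ.comp (i + 1) : ℤ) - κ.comp (i + 1)) * (κ.comp i : ℤ)) *
        gaussCoeff q ((μ.comp (i + 1) : ℤ) - κ.comp i) (κ.comp (i + 1) - κ.comp i) := by
    rw [shapeCoeff, ← Finset.Ico_add_one_right_eq_Icc, Finset.prod_Ico_eq_prod_range,
      Nat.add_sub_cancel]
    refine Finset.prod_congr rfl fun i _ => ?_
    rw [add_comm 1 i, Nat.add_sub_cancel]
  have hpow : ∀ ν : ChainShape s, ∏ i ∈ Finset.range s,
      ∏ _j ∈ Finset.Ico (κ.comp i) (κ.comp (i + 1)), (q : ℚ) ^ ν.tailSum (i + 1) =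
      (q : ℚ) ^ (∑ i ∈ Finset.range s,
        (ν.tailSum (i + 1) : ℤ) * ((κ.comp (i + 1) : ℤ) - κ.comp i)) := by
    intro ν
    have h : ∀ i ∈ Finset.range s, (ν.tailSum (i + 1) : ℤ) * ((κ.comp (i + 1) : ℤ) - κ.comp i) =
        (ν.tailSum (i + 1) * (κ.comp (i + 1) - κ.comp i) : ℕ) := fun i hi => by
      rw [Nat.cast_mul, Nat.cast_sub (κ.comp_le_comp (Nat.le_succ i) (Finset.mem_range.1 hi))]
    rw [Finset.sum_congr rfl h, ← Nat.cast_sum, zpow_natCast, ← Finset.prod_pow_eq_pow_sum]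
    simp only [Finset.prod_const, Nat.card_Ico, ← pow_mul]
  have hpowz : ∏ i ∈ Finset.range s,
      (q : ℚ) ^ (((μ.comp (i + 1) : ℤ) - κ.comp (i + 1)) * (κ.comp i : ℤ)) =
      (q : ℚ) ^ (∑ i ∈ Finset.range s,
        (((μ.comp (i + 1) : ℤ) - κ.comp (i + 1)) * (κ.comp i : ℤ))) := by
    generalize Finset.range s = S
    induction S using Finset.cons_induction with
    | empty => simp
    | cons a S ha ih => rw [Finset.prod_cons, Finset.sum_cons, zpow_add₀ hq0, ih]
  have hgauss : ∀ i ∈ Finset.range s,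
      gaussCoeff q ((μ.comp (i + 1) : ℤ) - κ.comp i) (κ.comp (i + 1) - κ.comp i) *
        ∏ j ∈ Finset.Ico (κ.comp i) (κ.comp (i + 1)), ((q : ℚ) ^ κ.comp (i + 1) - (q : ℚ) ^ j) =
      ∏ j ∈ Finset.Ico (κ.comp i) (κ.comp (i + 1)), ((q : ℚ) ^ μ.comp (i + 1) - (q : ℚ) ^ j) :=
    fun i hi => gaussCoeff_mul_prod hq _ _ _
      (κ.comp_le_comp (Nat.le_succ i) (Finset.mem_range.1 hi))
  have hexp := sum_tail_mul_sub (fun i => (μ.comp (i + 1) : ℤ) - κ.comp (i + 1))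
    (fun i => (κ.comp i : ℤ)) (by simp) s
  have hexp' : ∑ i ∈ Finset.range s,
        (((μ.comp (i + 1) : ℤ) - κ.comp (i + 1)) * (κ.comp i : ℤ)) +
      ∑ i ∈ Finset.range s, (κ.tailSum (i + 1) : ℤ) * ((κ.comp (i + 1) : ℤ) - κ.comp i) =
      ∑ i ∈ Finset.range s, (μ.tailSum (i + 1) : ℤ) * ((κ.comp (i + 1) : ℤ) - κ.comp i) := by
    rw [← hexp, ← Finset.sum_add_distrib]
    refine Finset.sum_congr rfl fun i _ => ?_
    rw [← add_mul, Finset.sum_sub_distrib]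
    simp only [ChainShape.tailSum, Nat.cast_sum]
    rw [sub_add_cancel]
  simp only [Finset.prod_mul_distrib] at hshape ⊢
  rw [hshape, hpow, hpow, hpowz, mul_mul_mul_comm, ← zpow_add₀ hq0, hexp',
    ← Finset.prod_mul_distrib, Finset.prod_congr rfl hgauss]

/-- In R^n the j-th factor is q^((s-l)n) - q^j q^((s-1-l)n) = q^((s-l)n) (1 - q^(j-n)), where l is
the level of j. -/
theorem natCard_generating_tuples {R : Type*} [CommRing R] {π : R} {q s : ℕ}
    (hR : IsFiniteChainRing R π q s) (n : ℕ) (κ : ChainShape s) :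
    (Nat.card {x : Fin n → shapeModule π κ // Submodule.span R (Set.range x) = ⊤} : ℚ) =
      (Nat.card (shapedMatrices π n κ) : ℚ) *
        ∏ i ∈ Finset.range (κ.comp s), (1 - (q : ℚ) ^ ((i : ℤ) - (n : ℤ))) := by
  have := hR.finite
  have hq0 : (q : ℚ) ≠ 0 := by have := hR.one_lt_card_residue; positivity
  have hl : ∀ j : Fin (κ.comp s), κ.level j < s := fun j => κ.level_lt j.2
  have h := chainModule.natCard_span_range_eq_top hR hl n
  refine (congr_arg Nat.cast h).trans ?_
  have hcard : Nat.card (shapeModule π κ) = ∏ j : Fin (κ.comp s), q ^ (s - κ.level j) :=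
    chainModule.natCard_eq hR
  rw [hR.natCard_socleIndependent hl fun i j hij => κ.level_mono hij, natCard_shapedMatrices,
    hcard, ← Finset.prod_pow, Nat.cast_prod,
    ← Fin.prod_univ_eq_prod_range (fun i => 1 - (q : ℚ) ^ ((i : ℤ) - (n : ℤ))),
    ← Finset.prod_mul_distrib]
  refine Finset.prod_congr rfl fun j _ => ?_
  have hj := hl j
  rw [hR.natCard_torsionBy_fin n (by omega), hR.natCard_torsionBy_fin n (by omega),
    show s - κ.level j = s - 1 - κ.level j + 1 by omega, zpow_sub₀ hq0, zpow_natCast, zpow_natCast]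
  push_cast
  field_simp
  ring

theorem mainTheorem1 {R : Type*} [CommRing R] (π : R) (q s : ℕ)
    (hR : IsFiniteChainRing R π q s) (n : ℕ) (μ κ : ChainShape s) :
    (Nat.card (shapedMatricesOfShape π n μ κ) : ℚ) =
        (Nat.card (shapedMatrices π n κ) : ℚ) *
          (∏ i ∈ Finset.range (κ.comp s), (1 - (q : ℚ) ^ ((i : ℤ) - (n : ℤ)))) *
          shapeCoeff q μ κ ∧
      (Nat.card {N : Submodule R (shapeModule π μ) // HasShape π N κ} : ℚ) = shapeCoeff q μ κ := by
  have := hR.finite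
  have hsub :
      (Nat.card {N : Submodule R (shapeModule π μ) // HasShape π N κ} : ℚ) = shapeCoeff q μ κ := by
    have hcount := natCard_injective_eq_card_submodules_mul (R := R) (M := shapeModule π μ)
      (P := shapeModule π κ)
    have hcoeff := shapeCoeff_mul_prod hR.one_lt_card_residue μ κ
    rw [← natCard_injective_shapeModule hR, ← natCard_injective_shapeModule hR, hcount,
      Nat.cast_mul] at hcoeff
    -- The number of automorphisms is to be cancelled; the identity shows that it is nonzero.
    have : Nonempty {f : shapeModule π κ →ₗ[R] shapeModule π κ // Function.Injective f} :=
      ⟨⟨LinearMap.id, Function.injective_id⟩⟩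
    have : Finite {f : shapeModule π κ →ₗ[R] shapeModule π κ // Function.Injective f} :=
      Finite.of_injective (fun f => (f.1 : shapeModule π κ → shapeModule π κ))
        (DFunLike.coe_injective.comp Subtype.val_injective)
    exact (mul_right_cancel₀ (Nat.cast_ne_zero.2 Nat.card_pos.ne') hcoeff).symm
  refine ⟨?_, hsub⟩
  rw [natCard_shapedMatricesOfShape, Nat.cast_mul, hsub, natCard_generating_tuples hR, mul_comm]
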